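/- Let $s$ be a positive integer and let $A^{(s)}(n)=\sum_{k=0}^{n}\binom{n}{k}^s$. Call a nonzero linear recurrence operator with polynomial coefficients $$P(n,N)=\sum_{i=0}^{r}p_i(n)N^i,\qquad p_i\in\mathbb{C}[n],\quad p_r\neq 0,$$ of order $r$, where $N$ is the shift operator $N u(n)=u(n+1)$, a telescoping recurrence operator for $A^{(s)}(n)$ based on this representation if there is a rational function $R(n,k)\in\mathbb{C}(n,k)$ such that $b(n,k)=R(n,k)\binom{n}{k}^s$ satisfies $$P(n,N)\binom{n}{k}^s=b(n,k+1)-b(n,k),$$ as an identity of rational functions in $n$ and $k$ after division by $\binom{n}{k}^s$ (equivalently, for all integers $n,k\ge 0$ for which $b(n,k)$ and $b(n,k+1)$ are defined, that is, at which a fixed denominator of $R$ does not vanish). Then every telescoping recurrence operator for $A^{(s)}(n)$ based on this representation has order $r\ge\lfloor (s+1)/2\rfloor$. This applies in particular to operators with integer coefficients and certificates $R\in\mathbb{Q}(n,k)$. -/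

import Mathlib

open Polynomial

namespace Franel

/-- A linear recurrence operator `P(n, N) = ∑ i, pᵢ(n) Nⁱ` with polynomial coefficients (written to
the left of the powers of the shift `N`) is stored as the polynomial `P : ℂ[X][X]` with
`P.coeff i = pᵢ`; its order is `P.natDegree`. This is its action on a sequence `u`, evaluated at `n`:
`∑ i, pᵢ(n) u(n + i)`. -/
noncomputable def applyOp (P : ℂ[X][X]) (u : ℕ → ℂ) (n : ℕ) : ℂ :=
  ∑ i ∈ Finset.range (P.natDegree + 1), (P.coeff i).eval (n : ℂ) * u (n + i)

/-- The summand `a(n, k) = (n choose k) ^ s`. -/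
noncomputable def summand (s n k : ℕ) : ℂ := ((n.choose k : ℕ) : ℂ) ^ s

/-- The term `b(n, k) = R(n, k) a(n, k)`, where `R = U / V` is a rational function of `n` (the inner
variable of `U`, `V`) and `k` (the outer one). It is meaningful where `V(n, k) ≠ 0`. -/
noncomputable def certTerm (U V : ℂ[X][X]) (s n k : ℕ) : ℂ :=
  U.evalEval (n : ℂ) (k : ℂ) / V.evalEval (n : ℂ) (k : ℂ) * summand s n k

/-- `P` is a telescoping recurrence operator for the sums `∑ k, (n choose k) ^ s`, based on this
representation: there is a rational function `R = U / V` such that `b(n, k) = R(n, k) a(n, k)`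
satisfies `P(n, N) a(n, k) = b(n, k + 1) - b(n, k)`, wherever both terms on the right are defined
(as these points with `k ≤ n` are Zariski dense, this is the same as the identity of rational
functions in `n` and `k` that results on division by `a(n, k)`). -/
def IsTelescoping (s : ℕ) (P : ℂ[X][X]) : Prop :=
  P ≠ 0 ∧ ∃ U V : ℂ[X][X], V ≠ 0 ∧ ∀ n k : ℕ,
    V.evalEval (n : ℂ) (k : ℂ) ≠ 0 → V.evalEval (n : ℂ) ((k + 1 : ℕ) : ℂ) ≠ 0 →
      applyOp P (fun m => summand s m k) n = certTerm U V s n (k + 1) - certTerm U V s n k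

end Franel

/-!
Fix a telescoping operator `P` of order `r`, with certificate `R`, and put
`f = R ∏_{1 ≤ j ≤ r} (n + j - k) ^ s / k ^ s`. The telescoping identity becomes
`f(n, k + 1) (n + r - k) ^ s - f(n, k) k ^ s = Q(n, k)` with `Q` a polynomial (`numerator`). As a
function of `k` over `ℂ(n)`, `f` has no poles: a pole `α` propagates upwards unless it reaches `0`
and downwards unless it reaches `n + r + 1`, and no `α` differs from both by
integers, `n` being transcendental (`dvd_of_shift_equation`). So `D(n) f = F(n, k)` is a polynomial
(`exists_polynomial_solution`).

Now let `n → ∞` along the line `k = x n`. If `F` has total degree `m` and leading form `φ`, the left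
side, multiplied by `D`, is `n ^ (m + s) φ(x) ((1 - x) ^ s - x ^ s)` to leading order, whereas the
right side is, up to a nonzero constant and a power of `n`, the reversed characteristic polynomial
`∑ cᵢ y ^ (r - i)` of `P` at `y = (1 - x) ^ s`. Hence this polynomial vanishes at `(1 - x) ^ s`
whenever `(1 - x) ^ s = x ^ s` (`eval_reverseChar_eq_zero`). The solutions
`x = (1 - i tan (π j / s)) / 2` with `2 j < s` give `⌊(s + 1) / 2⌋` values of `(1 - x) ^ s`, with
distinct absolute values `(2 cos (π j / s)) ^ (-s)`, so a nonzero polynomial of degree at most `r` has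
that many roots.
-/

namespace Franel

/-! ### The polynomial form of the telescoping identity -/

@[simp]
lemma evalEval_comp_X_add_one {R : Type*} [CommSemiring R] (x y : R) (p : R[X][X]) :
    (p.comp (X + 1)).evalEval x y = p.evalEval x (y + 1) := by
  simp [evalEval, eval_comp]

/-- The points `(n, k)` with `k ≤ n` natural numbers are Zariski dense in the plane: each `n` beyond
the degree in `k` gives more than enough points. -/
lemma eq_zero_of_evalEval_natCast {H : ℂ[X][X]}
    (h : ∀ n k : ℕ, k ≤ n → H.evalEval (n : ℂ) (k : ℂ) = 0) : H = 0 := by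
  have key : ∀ n : ℕ, H.natDegree ≤ n → H.map (evalRingHom (n : ℂ)) = 0 := by
    intro n hn
    refine eq_zero_of_natDegree_lt_card_of_eval_eq_zero' _
      ((Finset.range (n + 1)).image (fun k : ℕ => (k : ℂ))) ?_ ?_
    · intro y hy
      obtain ⟨k, hk, rfl⟩ := Finset.mem_image.1 hy
      have := h n k (by simpa [Nat.lt_succ_iff] using hk)
      rwa [← map_evalRingHom_eval] at this
    · rw [Finset.card_image_of_injective _ Nat.cast_injective, Finset.card_range]
      exact Nat.lt_succ_of_le (natDegree_map_le.trans hn)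
  ext1 b
  rw [coeff_zero]
  refine eq_zero_of_infinite_isRoot _ (Set.Infinite.mono ?_
    ((Set.Ici_infinite H.natDegree).image (Nat.cast_injective (R := ℂ)).injOn))
  rintro _ ⟨n, hn, rfl⟩
  simpa using congrArg (fun p => p.coeff b) (key n hn)

/-- The numerator in `k` of `P(n, N) a(n, k) / a(n, k)`, over the common denominator
`∏ j ≤ r, (n + j - k) ^ s`, where `r` is the order of `P`. -/
noncomputable def numerator (s : ℕ) (P : ℂ[X][X]) : ℂ[X][X] :=
  ∑ i ∈ Finset.range (P.natDegree + 1), C (P.coeff i) *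
    (∏ j ∈ Finset.range i, (C X + ((j + 1 : ℕ) : ℂ[X][X]))) ^ s *
    (∏ j ∈ Finset.Ico i P.natDegree, (C X + ((j + 1 : ℕ) : ℂ[X][X]) - X)) ^ s

lemma evalEval_numerator (s : ℕ) (P : ℂ[X][X]) (x y : ℂ) :
    (numerator s P).evalEval x y = ∑ i ∈ Finset.range (P.natDegree + 1), (P.coeff i).eval x *
      (∏ j ∈ Finset.range i, (x + ((j + 1 : ℕ) : ℂ))) ^ s *
      (∏ j ∈ Finset.Ico i P.natDegree, (x + ((j + 1 : ℕ) : ℂ) - y)) ^ s := by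
  simp [numerator, evalEval, eval_finsetSum, eval_prod]

lemma choose_add_mul_prod (n k i : ℕ) :
    ((n + i).choose k : ℂ) * ∏ j ∈ Finset.range i, ((n : ℂ) + ((j + 1 : ℕ) : ℂ) - k) =
      n.choose k * ∏ j ∈ Finset.range i, ((n : ℂ) + ((j + 1 : ℕ) : ℂ)) := by
  induction i with
  | zero => simp
  | succ i ih =>
    have h : ((n + i + 1).choose k : ℂ) * ((n : ℂ) + ((i + 1 : ℕ) : ℂ) - k) =
        (n + i).choose k * ((n : ℂ) + ((i + 1 : ℕ) : ℂ)) := by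
      rcases le_or_gt k (n + i + 1) with hk | hk
      · have := congrArg (Nat.cast : ℕ → ℂ) (Nat.choose_mul_succ_eq (n + i) k)
        push_cast [Nat.cast_sub hk] at this ⊢
        linear_combination -this
      · simp [Nat.choose_eq_zero_of_lt hk, Nat.choose_eq_zero_of_lt (Nat.lt_of_succ_lt hk)]
    rw [Finset.prod_range_succ, Finset.prod_range_succ, ← add_assoc]
    linear_combination (∏ j ∈ Finset.range i, ((n : ℂ) + ((j + 1 : ℕ) : ℂ) - k)) * h +
      ((n : ℂ) + ((i + 1 : ℕ) : ℂ)) * ih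

lemma applyOp_summand_mul_prod (s : ℕ) (P : ℂ[X][X]) (n k : ℕ) :
    applyOp P (fun m => summand s m k) n *
        (∏ j ∈ Finset.range P.natDegree, ((n : ℂ) + ((j + 1 : ℕ) : ℂ) - k)) ^ s =
      summand s n k * (numerator s P).evalEval (n : ℂ) (k : ℂ) := by
  rw [evalEval_numerator, applyOp, Finset.sum_mul, Finset.mul_sum]
  refine Finset.sum_congr rfl fun i hi => ?_
  have hi' : i ≤ P.natDegree := by simpa [Nat.lt_succ_iff] using hi
  have h := congrArg (· ^ s) (choose_add_mul_prod n k i)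
  simp only [mul_pow] at h
  rw [← Finset.prod_range_mul_prod_Ico _ hi', mul_pow, summand, summand]
  linear_combination ((P.coeff i).eval (n : ℂ) *
    (∏ j ∈ Finset.Ico i P.natDegree, ((n : ℂ) + ((j + 1 : ℕ) : ℂ) - k)) ^ s) * h

lemma summand_succ_mul (s n k : ℕ) (hk : k ≤ n) :
    summand s n (k + 1) * ((k : ℂ) + 1) ^ s = summand s n k * ((n : ℂ) - k) ^ s := by
  have := congrArg (Nat.cast : ℕ → ℂ) (Nat.choose_succ_right_eq n k)
  push_cast [Nat.cast_sub hk] at this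
  rw [summand, summand, ← mul_pow, ← mul_pow, this]

/-- With `R = U / V` and `f = R ∏ j ≤ r, (n + j - k) ^ s / k ^ s = u / v`, the telescoping identity
reads `f(k + 1) (n + r - k) ^ s - f(k) k ^ s = numerator`. -/
lemma IsTelescoping.exists_fraction {s : ℕ} {P : ℂ[X][X]} (hP : IsTelescoping s P) :
    ∃ u v : ℂ[X][X], v ≠ 0 ∧
      u.comp (X + 1) * v * (C (X + (P.natDegree : ℂ[X])) - X) ^ s - u * v.comp (X + 1) * X ^ s =
        numerator s P * v * v.comp (X + 1) := by
  obtain ⟨-, U, V, hV, h⟩ := hP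
  have hV' : V.comp (X + 1) ≠ 0 := by
    rw [← C_1, Ne, comp_X_add_C_eq_zero_iff]
    exact hV
  refine ⟨U * (∏ j ∈ Finset.range P.natDegree, (C X + ((j + 1 : ℕ) : ℂ[X][X]) - X)) ^ s, V * X ^ s,
    mul_ne_zero hV (pow_ne_zero _ X_ne_zero), ?_⟩
  rw [← sub_eq_zero]
  refine (mul_eq_zero.1 ?_).resolve_right (mul_ne_zero hV hV')
  refine eq_zero_of_evalEval_natCast fun n k hk => ?_
  rw [evalEval_mul, mul_eq_zero, or_iff_not_imp_right, evalEval_mul, evalEval_comp_X_add_one]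
  intro hne
  obtain ⟨h1, h2⟩ := mul_ne_zero_iff.1 hne
  have ha : summand s n k ≠ 0 := pow_ne_zero _ (by exact_mod_cast (Nat.choose_pos hk).ne')
  have hE := h n k h1 (by push_cast; exact h2)
  have hQ := applyOp_summand_mul_prod s P n k
  have hS := summand_succ_mul s n k hk
  rw [hE, certTerm, certTerm] at hQ
  push_cast at hQ
  generalize hq : (numerator s P).evalEval (n : ℂ) (k : ℂ) = q at *
  -- Replacing `k` by `k + 1` in the product drops its last factor and gains `n - k`.
  have hshift : (∏ j ∈ Finset.range P.natDegree, ((n : ℂ) + ((j : ℂ) + 1) - ((k : ℂ) + 1))) *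
      ((n : ℂ) + P.natDegree - k) =
      (∏ j ∈ Finset.range P.natDegree, ((n : ℂ) + ((j : ℂ) + 1) - k)) * ((n : ℂ) - k) := by
    have e := Finset.prod_range_succ (fun j : ℕ => ((n : ℂ) + j - k)) P.natDegree
    rw [Finset.prod_range_succ'] at e
    push_cast at e
    rw [add_zero] at e
    rw [e]
    congr 1
    exact Finset.prod_congr rfl fun j _ => by ring
  have hshift := congrArg (· ^ s) hshift
  simp only [mul_pow] at hshift
  simp only [evalEval_sub, evalEval_mul, evalEval_pow, hq, evalEval_comp_X_add_one, mul_comp,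
    pow_comp]
  -- What is left is an identity in the values of `U`, `V` and the two products.
  simp only [evalEval, eval_prod, eval_sub, eval_add, eval_X, eval_C, eval_natCast,
    eval_one, Nat.cast_add, Nat.cast_one] at *
  generalize (∏ j ∈ Finset.range P.natDegree, ((n : ℂ) + ((j : ℂ) + 1) - ((k : ℂ) + 1))) ^ s = d' at *
  generalize (∏ j ∈ Finset.range P.natDegree, ((n : ℂ) + ((j : ℂ) + 1) - k)) ^ s = d at *
  generalize eval (n : ℂ) (eval (C (k : ℂ)) V) = v at *
  generalize eval (n : ℂ) (eval (C ((k : ℂ) + 1)) V) = v' at *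
  generalize eval (n : ℂ) (eval (C (k : ℂ)) U) = u at *
  generalize eval (n : ℂ) (eval (C ((k : ℂ) + 1)) U) = u' at *
  have hQ' : (u' * summand s n (k + 1) * v - u * summand s n k * v') * d =
      summand s n k * q * v * v' := by
    field_simp at hQ
    linear_combination hQ
  refine (mul_eq_zero.1 ?_).resolve_left ha
  linear_combination (summand s n k * u' * v * (k : ℂ) ^ s) * hshift -
    (u' * v * (k : ℂ) ^ s * d) * hS + ((k : ℂ) ^ s * ((k : ℂ) + 1) ^ s) * hQ'

/-! ### Absence of poles -/

/-- The denominator of a solution divides its numerator. A pole `α` of `f = u / v` away from `0`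
forces a pole at `α + 1`, and one away from `a + 1` forces a pole at `α - 1`; as poles are finite in
number, `α` lies in `-ℕ` and in `a + 1 + ℕ`, which are disjoint. -/
lemma dvd_of_shift_equation {K : Type*} [Field K] [CharZero K] {a : K} (ha : ∀ m : ℕ, a + m ≠ 0)
    (s : ℕ) {u v q : K[X]} (hv : v ≠ 0)
    (h : u.comp (X + 1) * v * (C a - X) ^ s - u * v.comp (X + 1) * X ^ s =
      q * v * v.comp (X + 1)) : v ∣ u := by
  classical
  obtain ⟨u', hu'⟩ := EuclideanDomain.gcd_dvd_left u v
  obtain ⟨v', hv'⟩ := EuclideanDomain.gcd_dvd_right u v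
  have hg : EuclideanDomain.gcd u v ≠ 0 := fun h0 => hv (EuclideanDomain.gcd_eq_zero_iff.1 h0).2
  have hco : IsCoprime u' v' := by
    obtain ⟨x, y, hxy⟩ : ∃ x y, EuclideanDomain.gcd u v = u * x + v * y :=
      ⟨_, _, EuclideanDomain.gcd_eq_gcd_ab u v⟩
    refine ⟨x, y, mul_left_cancel₀ hg ?_⟩
    linear_combination -hxy - x * hu' - y * hv'
  generalize EuclideanDomain.gcd u v = g at *
  have hg' : g.comp (X + 1) ≠ 0 := by
    rw [← C_1, Ne, comp_X_add_C_eq_zero_iff]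
    exact hg
  have hv0 : v' ≠ 0 := by
    rintro rfl
    exact hv (by simpa using hv')
  rw [hu', hv'] at h
  simp only [mul_comp] at h
  have h1 : u'.comp (X + 1) * v' * (C a - X) ^ s - u' * v'.comp (X + 1) * X ^ s =
      q * v' * v'.comp (X + 1) := by
    refine mul_left_cancel₀ (mul_ne_zero hg hg') ?_
    linear_combination h
  let L := AlgebraicClosure K
  have : CharZero L := charZero_of_injective_algebraMap (algebraMap K L).injective
  have hcoL : ∀ α : L, aeval α v' = 0 → aeval α u' ≠ 0 := by
    intro α h1 h2
    obtain ⟨x, y, hxy⟩ := hco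
    simpa [h1, h2] using congrArg (aeval α) hxy
  have hE : ∀ α : L, aeval (α + 1) u' * aeval α v' * (algebraMap K L a - α) ^ s -
      aeval α u' * aeval (α + 1) v' * α ^ s = aeval α q * aeval α v' * aeval (α + 1) v' := by
    intro α
    simpa [aeval_comp] using congrArg (aeval α) h1
  have hup : ∀ α : L, aeval α v' = 0 → α ≠ 0 → aeval (α + 1) v' = 0 := by
    intro α h0 hα
    have := hE α
    simpa [h0, hcoL α h0, hα] using this
  have hdown : ∀ α : L, aeval (α + 1) v' = 0 → α ≠ algebraMap K L a → aeval α v' = 0 := by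
    intro α h0 hα
    have := hE α
    simpa [h0, hcoL _ h0, sub_eq_zero, hα.symm] using this
  -- Only finitely many points of an arithmetic progression are roots of `v'`.
  have hfin : ∀ c : L, c ≠ 0 → ∀ α : L, ¬ ∀ m : ℕ, aeval (α + m * c) v' = 0 := by
    intro c hc α hall
    refine hv0 ((Polynomial.map_eq_zero (algebraMap K L)).1 (eq_zero_of_infinite_isRoot _
      (Set.Infinite.mono ?_ (Set.infinite_range_of_injective
        (f := fun m : ℕ => α + m * c) ?_))))
    · rintro _ ⟨m, rfl⟩
      simpa [IsRoot, eval_map_algebraMap] using hall m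
    · intro m m' hm
      simpa [hc] using hm
  have hroot : ∀ α : L, aeval α v' ≠ 0 := by
    intro α h0
    have e1 : ∃ i : ℕ, α + i = 0 := by
      by_contra! hne
      refine hfin 1 one_ne_zero α fun m => ?_
      induction m with
      | zero => simpa using h0
      | succ m ih =>
        have := hup _ ih (by simpa using hne m)
        simpa [add_assoc] using this
    have e2 : ∃ j : ℕ, α - j - 1 = algebraMap K L a := by
      by_contra! hne
      refine hfin (-1) (by simp) α fun m => ?_
      induction m with
      | zero => simpa using h0
      | succ m ih =>
        refine hdown _ ?_ ?_
        · rw [← ih, show α + ((m + 1 : ℕ) : L) * (-1) + 1 = α + m * (-1) by push_cast; ring]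
        · have := hne m
          rwa [show α - (m : L) - 1 = α + ((m + 1 : ℕ) : L) * (-1) by push_cast; ring] at this
    obtain ⟨i, hi⟩ := e1
    obtain ⟨j, hj⟩ := e2
    refine ha (i + j + 1) ((algebraMap K L).injective ?_)
    push_cast [map_add, map_natCast, map_zero, map_one]
    linear_combination hi - hj
  have hdeg : v'.degree = 0 := by
    by_contra hd
    obtain ⟨α, hα⟩ := IsAlgClosed.exists_aeval_eq_zero L v' hd
    exact hroot α hα
  have hun : IsUnit v' := isUnit_iff_degree_eq_zero.2 hdeg
  rw [hv', hu']
  exact mul_dvd_mul_left _ hun.dvd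

/-- A solution of the shift equation that is a fraction over `ℂ(n)` is a polynomial in `k` up to a
common denominator `D(n)`. -/
lemma exists_polynomial_solution {r s : ℕ} {u v q : ℂ[X][X]} (hv : v ≠ 0)
    (h : u.comp (X + 1) * v * (C (X + (r : ℂ[X])) - X) ^ s - u * v.comp (X + 1) * X ^ s =
      q * v * v.comp (X + 1)) :
    ∃ (D : ℂ[X]) (F : ℂ[X][X]), D ≠ 0 ∧
      F.comp (X + 1) * (C (X + (r : ℂ[X])) - X) ^ s - F * X ^ s = C D * q := by
  let K := FractionRing ℂ[X]
  let φ : ℂ[X] →+* K := algebraMap ℂ[X] K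
  have hφ : Function.Injective φ := IsFractionRing.injective ℂ[X] K
  have : CharZero K := charZero_of_injective_algebraMap hφ
  have ha : ∀ m : ℕ, φ (X + (r : ℂ[X])) + m ≠ 0 := by
    intro m hm
    have : (X + C ((r : ℂ) + m) : ℂ[X]) = 0 := hφ (by simpa [add_assoc] using hm)
    exact X_add_C_ne_zero _ this
  have hvφ : v.map φ ≠ 0 := by rwa [Ne, Polynomial.map_eq_zero_iff hφ]
  have hmap := congrArg (Polynomial.map φ) h
  simp only [Polynomial.map_sub, Polynomial.map_mul, Polynomial.map_pow, Polynomial.map_comp,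
    Polynomial.map_X, Polynomial.map_C, Polynomial.map_add, Polynomial.map_one] at hmap
  obtain ⟨f, hf⟩ := dvd_of_shift_equation ha s hvφ hmap
  have hvφ' : (v.map φ).comp (X + 1) ≠ 0 := by
    rw [← C_1, Ne, comp_X_add_C_eq_zero_iff]
    exact hvφ
  rw [hf, mul_comp] at hmap
  have hfe : f.comp (X + 1) * (C (φ (X + (r : ℂ[X]))) - X) ^ s - f * X ^ s = q.map φ := by
    refine mul_left_cancel₀ (mul_ne_zero hvφ hvφ') ?_
    linear_combination hmap
  obtain ⟨D, hD, hDF⟩ := IsLocalization.integerNormalization_spec (nonZeroDivisors ℂ[X]) f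
  have hF : (IsLocalization.integerNormalization (nonZeroDivisors ℂ[X]) f).map φ = C (φ D) * f := by
    rw [hDF, Algebra.smul_def, Polynomial.algebraMap_apply]
  refine ⟨D, IsLocalization.integerNormalization (nonZeroDivisors ℂ[X]) f,
    nonZeroDivisors.ne_zero hD, Polynomial.map_injective φ hφ ?_⟩
  simp only [Polynomial.map_sub, Polynomial.map_mul, Polynomial.map_pow, Polynomial.map_comp,
    Polynomial.map_X, Polynomial.map_C, Polynomial.map_add, Polynomial.map_one, hF, ← hfe, mul_comp,
    C_comp]
  ring

/-! ### Leading terms along the lines `k = x n` -/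

open Filter Topology

lemma tendsto_inv_natCast : Tendsto (fun t : ℕ => (t : ℂ)⁻¹) atTop (𝓝 0) :=
  tendsto_inv_atTop_nhds_zero_nat (𝕜 := ℂ)

lemma tendsto_eval_div_pow {p : ℂ[X]} {N : ℕ} (hp : p.natDegree ≤ N) :
    Tendsto (fun t : ℕ => p.eval (t : ℂ) / (t : ℂ) ^ N) atTop (𝓝 (p.coeff N)) := by
  have h : Tendsto (fun t : ℕ => (p.reflect N).eval ((t : ℂ)⁻¹)) atTop
      (𝓝 ((p.reflect N).eval 0)) :=
    ((p.reflect N).continuous.tendsto 0).comp tendsto_inv_natCast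
  have e : (p.reflect N).eval 0 = p.coeff N := by
    rw [← coeff_zero_eq_eval_zero, coeff_reflect, revAt_le (Nat.zero_le N), Nat.sub_zero]
  rw [e] at h
  refine h.congr' ?_
  filter_upwards [eventually_ne_atTop 0] with t ht
  have ht' : (t : ℂ) ≠ 0 := by exact_mod_cast ht
  let := invertibleOfNonzero ht'
  have := eval₂_reflect_mul_pow (RingHom.id ℂ) (t : ℂ) N p hp
  rw [invOf_eq_inv] at this
  exact eq_div_of_mul_eq (pow_ne_zero _ ht') this

lemma tendsto_linear_div (x c : ℂ) :
    Tendsto (fun t : ℕ => (x * t + c) / (t : ℂ)) atTop (𝓝 x) := by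
  have h : Tendsto (fun t : ℕ => x + c * (t : ℂ)⁻¹) atTop (𝓝 (x + c * 0)) :=
    (tendsto_inv_natCast.const_mul c).const_add x
  rw [mul_zero, add_zero] at h
  refine h.congr' ?_
  filter_upwards [eventually_ne_atTop 0] with t ht
  have ht' : (t : ℂ) ≠ 0 := by exact_mod_cast ht
  field_simp

/-- A nonzero polynomial in `n` and `k` of total degree `m` has a leading form along the lines
`k = x n + c`: a nonzero polynomial in the slope `x`, not depending on `c`. -/
lemma exists_leading_form {F : ℂ[X][X]} (hF : F ≠ 0) :
    ∃ (m : ℕ) (φ : ℂ[X]), φ ≠ 0 ∧ ∀ x c : ℂ,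
      Tendsto (fun t : ℕ => F.evalEval (t : ℂ) (x * t + c) / (t : ℂ) ^ m) atTop
        (𝓝 (φ.eval x)) := by
  obtain ⟨b₀, hb₀, hmax⟩ := F.support.exists_max_image (fun b => (F.coeff b).natDegree + b)
    (support_nonempty.2 hF)
  set m := (F.coeff b₀).natDegree + b₀ with hm
  refine ⟨m, ∑ b ∈ F.support, C ((F.coeff b).coeff (m - b)) * X ^ b, ?_, fun x c => ?_⟩
  · intro h0
    have := congrArg (fun p => p.coeff b₀) h0
    have hc := leadingCoeff_eq_zero.1 (by simpa [coeff_X_pow, hm] using this)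
    exact mem_support_iff.1 hb₀ hc
  · simp only [evalEval, eval_eq_sum (p := F), Polynomial.sum, eval_finsetSum, Finset.sum_div,
      eval_mul, eval_pow, eval_C, eval_X]
    refine tendsto_finsetSum _ fun b hb => ?_
    have hbm : (F.coeff b).natDegree + b ≤ m := hmax b hb
    refine ((tendsto_eval_div_pow (p := F.coeff b) (N := m - b) (by omega)).mul
      ((tendsto_linear_div x c).pow b)).congr fun t => ?_
    rw [div_pow, div_mul_div_comm, ← pow_add, Nat.sub_add_cancel (by omega)]

/-- The characteristic polynomial `∑ i, cᵢ y ^ (r - i)` of `P` with the order of its coefficients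
reversed, where `cᵢ` is the coefficient of `n ^ d` in `pᵢ`. -/
noncomputable def reverseChar (P : ℂ[X][X]) (d : ℕ) : ℂ[X] :=
  ∑ i ∈ Finset.range (P.natDegree + 1), C ((P.coeff i).coeff d) * X ^ (P.natDegree - i)

lemma natDegree_reverseChar_le (P : ℂ[X][X]) (d : ℕ) :
    (reverseChar P d).natDegree ≤ P.natDegree :=
  natDegree_sum_le_of_forall_le _ _ fun _ _ =>
    (natDegree_C_mul_X_pow_le _ _).trans (Nat.sub_le _ _)

lemma exists_reverseChar_ne_zero {P : ℂ[X][X]} (hP : P ≠ 0) :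
    ∃ d, (∀ i, (P.coeff i).natDegree ≤ d) ∧ reverseChar P d ≠ 0 := by
  obtain ⟨b, hb, hmax⟩ := P.support.exists_max_image (fun b => (P.coeff b).natDegree)
    (support_nonempty.2 hP)
  refine ⟨(P.coeff b).natDegree, fun i => ?_, fun h0 => ?_⟩
  · by_cases hi : i ∈ P.support
    · exact hmax i hi
    · simp [notMem_support_iff.1 hi]
  · have hbr := le_natDegree_of_mem_supp b hb
    have := congrArg (fun p => p.coeff (P.natDegree - b)) h0
    simp only [reverseChar, finsetSum_coeff, coeff_C_mul, coeff_X_pow, coeff_zero] at this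
    rw [Finset.sum_eq_single b] at this
    · simp at this
      exact mem_support_iff.1 hb this
    · intro i hi hib
      rw [if_neg, mul_zero]
      have := Finset.mem_range.1 hi
      omega
    · intro hb'
      exact absurd (Finset.mem_range.2 (Nat.lt_succ_of_le hbr)) hb'

/-- The leading term of the right side on the line `k = x n`. -/
lemma tendsto_numerator {P : ℂ[X][X]} {d : ℕ} (hd : ∀ i, (P.coeff i).natDegree ≤ d) (s : ℕ)
    (x : ℂ) :
    Tendsto (fun t : ℕ => (numerator s P).evalEval (t : ℂ) (x * t) /
      (t : ℂ) ^ (d + P.natDegree * s)) atTop (𝓝 ((reverseChar P d).eval ((1 - x) ^ s))) := by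
  simp only [evalEval_numerator, reverseChar, eval_finsetSum, Finset.sum_div, eval_mul, eval_C,
    eval_pow, eval_X]
  refine tendsto_finsetSum _ fun i hi => ?_
  have hi' : i ≤ P.natDegree := by simpa [Nat.lt_succ_iff] using hi
  have h1 := tendsto_finsetProd (Finset.range i) fun j _ =>
    tendsto_linear_div 1 ((j + 1 : ℕ) : ℂ)
  have h2 := tendsto_finsetProd (Finset.Ico i P.natDegree) fun j _ =>
    tendsto_linear_div (1 - x) ((j + 1 : ℕ) : ℂ)
  have h3 := ((tendsto_eval_div_pow (hd i)).mul (h1.pow s)).mul (h2.pow s)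
  simp only [Finset.prod_const_one, one_pow, mul_one, Finset.prod_const, Nat.card_Ico,
    Finset.prod_div_distrib, Finset.card_range] at h3
  rw [← pow_mul, mul_comm _ s, pow_mul] at h3
  refine h3.congr fun t => ?_
  rw [div_pow, div_pow, div_mul_div_comm, div_mul_div_comm, ← pow_mul, ← pow_mul, ← pow_add,
    ← pow_add, add_assoc, ← add_mul, Nat.add_sub_cancel' hi']
  congr 4
  · exact Finset.prod_congr rfl fun j _ => by ring
  · funext j
    ring

/-- Comparison of leading terms in `F(n, k + 1) (n + r - k) ^ s - F(n, k) k ^ s = D(n) numerator` on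
the lines `k = x n`. For generic `x` the leading term of the left side survives, so the exponent of
the right side is at least that of the left. On a line with `(1 - x) ^ s = x ^ s` the leading term of
the left side cancels, hence so does that of the right side. -/
lemma eval_reverseChar_eq_zero {s : ℕ} (hs : 0 < s) {P F : ℂ[X][X]} {D : ℂ[X]} (hD : D ≠ 0)
    (h : F.comp (X + 1) * (C (X + (P.natDegree : ℂ[X])) - X) ^ s - F * X ^ s =
      C D * numerator s P) {d : ℕ} (hd : ∀ i, (P.coeff i).natDegree ≤ d) {x : ℂ}
    (hx : (1 - x) ^ s = x ^ s) : (reverseChar P d).eval ((1 - x) ^ s) = 0 := by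
  have hR : ∀ x : ℂ, Tendsto (fun t : ℕ => (C D * numerator s P).evalEval (t : ℂ) (x * t) /
      (t : ℂ) ^ (D.natDegree + (d + P.natDegree * s))) atTop
      (𝓝 (D.leadingCoeff * (reverseChar P d).eval ((1 - x) ^ s))) := fun x => by
    refine ((tendsto_eval_div_pow le_rfl).mul (tendsto_numerator hd s x)).congr fun t => ?_
    rw [div_mul_div_comm, ← pow_add, evalEval_mul, evalEval_C]
  generalize D.natDegree + (d + P.natDegree * s) = e' at hR
  have hlim : ∀ x l : ℂ, Tendsto (fun t : ℕ => (C D * numerator s P).evalEval (t : ℂ) (x * t) /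
      (t : ℂ) ^ e') atTop (𝓝 l) → l = D.leadingCoeff * (reverseChar P d).eval ((1 - x) ^ s) :=
    fun x l hl => tendsto_nhds_unique hl (hR x)
  suffices h0 : D.leadingCoeff * (reverseChar P d).eval ((1 - x) ^ s) = 0 from
    (mul_eq_zero.1 h0).resolve_left (leadingCoeff_ne_zero.2 hD)
  by_cases hF : F = 0
  · refine (hlim x 0 ?_).symm
    simp [← h, hF]
  obtain ⟨m, φ, hφ, hlead⟩ := exists_leading_form hF
  have hL : ∀ x : ℂ, Tendsto (fun t : ℕ => (C D * numerator s P).evalEval (t : ℂ) (x * t) /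
      (t : ℂ) ^ (m + s)) atTop (𝓝 (φ.eval x * ((1 - x) ^ s - x ^ s))) := fun x => by
    have h1 := ((hlead x 1).mul ((tendsto_linear_div (1 - x) P.natDegree).pow s)).sub
      ((hlead x 0).mul ((tendsto_linear_div x 0).pow s))
    rw [← mul_sub] at h1
    refine h1.congr fun t => ?_
    rw [← h, div_pow, div_pow, div_mul_div_comm, div_mul_div_comm, ← pow_add, ← sub_div]
    simp only [evalEval_sub, evalEval_mul, evalEval_comp_X_add_one, evalEval_pow, evalEval_X,
      evalEval_C, eval_add, eval_X, eval_natCast, add_zero]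
    congr 4
    ring
  have hsplit : ∀ (y : ℂ) (a b c : ℕ), a = b + c → ∀ t : ℂ, y / t ^ a = y / t ^ b * t⁻¹ ^ c := by
    rintro y _ b c rfl t
    rw [inv_pow, ← div_eq_mul_inv, div_div, pow_add]
  rcases le_or_gt (m + s) e' with hle | hlt
  · obtain ⟨c, hc⟩ := Nat.exists_eq_add_of_le hle
    refine (hlim x 0 ?_).symm
    have := (hL x).mul (tendsto_inv_natCast.pow c)
    rw [hx, sub_self, mul_zero, zero_mul] at this
    exact this.congr fun t => (hsplit _ _ _ _ hc _).symm
  · -- If the left side grew faster, its leading term would vanish on every line.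
    exfalso
    obtain ⟨c, hc⟩ := Nat.exists_eq_add_of_lt hlt
    have hz : φ * ((1 - X) ^ s - X ^ s) = 0 := by
      refine Polynomial.funext fun x => ?_
      have := (hR x).mul (tendsto_inv_natCast.pow (c + 1))
      rw [zero_pow (Nat.succ_ne_zero c), mul_zero] at this
      simpa using tendsto_nhds_unique (hL x)
        (this.congr fun t => (hsplit _ _ _ _ (by omega) _).symm)
    have := congrArg (eval 0) ((mul_eq_zero.1 hz).resolve_left hφ)
    simp [hs.ne'] at this

/-! ### The eigenvalues -/

/-- The slope `(1 - i tan (π j / s)) / 2 = 1 / (1 + exp (2 π i j / s))`, at which the ratio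
`((1 - x) / x) ^ s` of consecutive summands tends to `1`. -/
noncomputable def criticalSlope (s j : ℕ) : ℂ :=
  (1 - Real.tan (Real.pi * j / s) * Complex.I) / 2

lemma angle_mem {s j : ℕ} (hj : j < (s + 1) / 2) :
    0 ≤ Real.pi * j / s ∧ Real.pi * j / s < Real.pi / 2 := by
  have hs : (0 : ℝ) < s := by exact_mod_cast (by omega : 0 < s)
  have h2 : (2 * j : ℝ) < s := by exact_mod_cast (by omega : 2 * j < s)
  refine ⟨by positivity, ?_⟩
  rw [div_lt_div_iff₀ hs two_pos]
  nlinarith [Real.pi_pos]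

lemma criticalSlope_spec {s j : ℕ} (hj : j < (s + 1) / 2) :
    (1 - criticalSlope s j) ^ s = criticalSlope s j ^ s := by
  obtain ⟨h0, h1⟩ := angle_mem hj
  have hs : (s : ℂ) ≠ 0 := by exact_mod_cast (by omega : s ≠ 0)
  set θ : ℝ := Real.pi * j / s with hθ
  have hcos : (Complex.cos θ) ≠ 0 := by
    rw [← Complex.ofReal_cos]
    exact_mod_cast (Real.cos_pos_of_mem_Ioo ⟨by linarith [Real.pi_pos], h1⟩).ne'
  have e : 1 - criticalSlope s j = criticalSlope s j * Complex.exp (2 * θ * Complex.I) := by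
    have e1 : Complex.exp (2 * θ * Complex.I) = Complex.exp (θ * Complex.I) ^ 2 := by
      rw [← Complex.exp_nat_mul]
      congr 1
      push_cast
      ring
    rw [criticalSlope, ← hθ, e1, Complex.exp_mul_I, Complex.ofReal_tan, Complex.tan_eq_sin_div_cos]
    have hsc := Complex.sin_sq_add_cos_sq θ
    field_simp
    linear_combination
      -(Complex.cos θ + Complex.sin θ * Complex.I) * hsc +
        (Complex.cos θ + Complex.sin θ * Complex.I) * Complex.sin θ ^ 2 * Complex.I_sq
  have hone : Complex.exp (2 * θ * Complex.I) ^ s = 1 := by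
    rw [← Complex.exp_nat_mul, Complex.exp_eq_one_iff]
    refine ⟨j, ?_⟩
    rw [hθ]
    push_cast
    field_simp
  rw [e, mul_pow, hone, mul_one]

lemma injOn_one_sub_criticalSlope_pow (s : ℕ) :
    Set.InjOn (fun j => (1 - criticalSlope s j) ^ s) (Finset.range ((s + 1) / 2)) := by
  intro i hi j hj hij
  have hi := Finset.mem_range.1 hi
  have hj := Finset.mem_range.1 hj
  have hs : s ≠ 0 := by omega
  have hnorm : ∀ j, Complex.normSq (1 - criticalSlope s j) =
      (1 + Real.tan (Real.pi * j / s) ^ 2) / 4 := fun j => by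
    have : 1 - criticalSlope s j =
        ((1 / 2 : ℝ) : ℂ) + ((Real.tan (Real.pi * j / s) / 2 : ℝ) : ℂ) * Complex.I := by
      rw [criticalSlope]
      push_cast
      ring
    rw [this, Complex.normSq_add_mul_I]
    ring
  have h1 := congrArg Complex.normSq hij
  simp only [map_pow] at h1
  have h2 := (pow_left_inj₀ (Complex.normSq_nonneg _) (Complex.normSq_nonneg _) hs).1 h1
  rw [hnorm, hnorm] at h2
  obtain ⟨hi0, hi1⟩ := angle_mem hi
  obtain ⟨hj0, hj1⟩ := angle_mem hj
  have h3 := (pow_left_inj₀ (Real.tan_nonneg_of_nonneg_of_le_pi_div_two hi0 hi1.le)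
    (Real.tan_nonneg_of_nonneg_of_le_pi_div_two hj0 hj1.le) two_ne_zero).1
    (by linarith)
  have hpi := Real.pi_pos
  have h4 := Real.injOn_tan ⟨by linarith, hi1⟩ ⟨by linarith, hj1⟩ h3
  have hs' : (s : ℝ) ≠ 0 := by exact_mod_cast hs
  field_simp at h4
  exact_mod_cast h4

end Franel

theorem theorem1 (s : ℕ) (hs : 0 < s) (P : Polynomial (Polynomial ℂ))
    (hP : Franel.IsTelescoping s P) : (s + 1) / 2 ≤ P.natDegree := by
  obtain ⟨u, v, hv, huv⟩ := hP.exists_fraction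
  obtain ⟨D, F, hD, hF⟩ := Franel.exists_polynomial_solution hv huv
  obtain ⟨d, hd, hne⟩ := Franel.exists_reverseChar_ne_zero hP.1
  refine le_trans ?_ (Franel.natDegree_reverseChar_le P d)
  by_contra! hlt
  refine hne (eq_zero_of_natDegree_lt_card_of_eval_eq_zero' _
    ((Finset.range ((s + 1) / 2)).image fun j => (1 - Franel.criticalSlope s j) ^ s) ?_ ?_)
  · intro y hy
    obtain ⟨j, hj, rfl⟩ := Finset.mem_image.1 hy
    exact Franel.eval_reverseChar_eq_zero hs hD hF hd
      (Franel.criticalSlope_spec (Finset.mem_range.1 hj))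
  · rwa [Finset.card_image_of_injOn (Franel.injOn_one_sub_criticalSlope_pow s), Finset.card_range]
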